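/- All filters are on $\omega$. For a family $\mathcal D$ of infinite subsets of $\omega$ let $\mathcal F_{\mathcal D}=\{F\subseteq\omega: D\setminus F \text{ is finite for all } D\in\mathcal D\}$. An AD-family is an infinite family $\mathcal A$ of infinite subsets of $\omega$ such that $A\cap B$ is finite for distinct $A,B\in\mathcal A$. Let $\mathcal I(\mathcal A)$ be the ideal of all $Y\subseteq\omega$ such that $Y\setminus\bigcup\mathcal A'$ is finite for some finite $\mathcal A'\subseteq\mathcal A$, and let $S_{\mathcal A}=\{\omega\setminus I: I\in\mathcal I(\mathcal A)\}$ be its dual filter. An AD-family $\mathcal A$ is an NMAD-family (nowhere maximal almost disjoint) if every $Y\subseteq\omega$ with $Y\notin\mathcal I(\mathcal A)$ has an infinite subset $B$ such that $B\cap I$ is finite for every $I\in\mathcal I(\mathcal A)$. It is completely separable if every infinite $M\subseteq\omega$ for which $\{A\in\mathcal A: A\cap M\text{ is infinite}\}$ is infinite contains some member of $\mathcal A$. For filters write $\mathcal F\le_{RK}\mathcal G$ if there is $f:\omega\to\omega$ with $\mathcal F=\{E\subseteq\omega: f^{-1}(E)\in\mathcal G\}$. For $x\in 2^\omega$ let $A_x=\{x|n:n<\omega\}\subseteq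 2^{<\omega}$, and for $X\subseteq 2^\omega$ let $\mathcal A_X=\{A_x:x\in X\}$, regarded as a family of subsets of $\omega$ through a bijection $2^{<\omega}\to\omega$. **Theorem.** Let $\mathcal A$ be a completely separable NMAD-family of cardinality $\mathfrak c=2^{\aleph_0}$. Then there is an infinite set $X\subseteq 2^\omega$ such that, for every infinite partition $\mathcal P$ of $\omega$ into infinite subsets and every bijection $2^{<\omega}\to\omega$ used to regard $\mathcal A_X$ as a family of subsets of $\omega$, the filters $\mathcal F_{\mathcal P}$, $S_{\mathcal A}$ and $S_{\mathcal A_X}$ form an RK-antichain, that is, no one of the three is $\le_{RK}$ another one. -/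

import Mathlib

open Set Filter

namespace RKFilters

/-- An almost disjoint family on `ω`: an infinite family of infinite subsets of `ω`, any two
distinct members of which have finite intersection. -/
structure IsAD (𝒜 : Set (Set ℕ)) : Prop where
  infinite : 𝒜.Infinite
  infinite_of_mem : ∀ A ∈ 𝒜, A.Infinite
  finite_inter : ∀ A ∈ 𝒜, ∀ B ∈ 𝒜, A ≠ B → (A ∩ B).Finite

/-- The ideal `ℐ(𝒜)`: the sets that are contained, up to a finite set, in the union of finitely
many members of `𝒜`. -/
def idealGen (𝒜 : Set (Set ℕ)) : Set (Set ℕ) :=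
  {Y | ∃ ℬ : Set (Set ℕ), ℬ ⊆ 𝒜 ∧ ℬ.Finite ∧ (Y \ ⋃₀ ℬ).Finite}

/-- The orthogonal `𝒟^⊥`: the infinite sets that meet every member of `𝒟` in a finite set. -/
def perp (𝒟 : Set (Set ℕ)) : Set (Set ℕ) :=
  {B | B.Infinite ∧ ∀ D ∈ 𝒟, (D ∩ B).Finite}

/-- Nowhere maximal almost disjoint families: every set outside the ideal `ℐ(𝒜)` has an infinite
subset in `ℐ(𝒜)^⊥`. -/
def IsNMAD (𝒜 : Set (Set ℕ)) : Prop :=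
  IsAD 𝒜 ∧ ∀ Y, Y ∉ idealGen 𝒜 → ∃ B ∈ perp (idealGen 𝒜), B ⊆ Y

/-- The collection `𝒜^*` of the infinite sets that meet infinitely many members of `𝒜` in an
infinite set. -/
def starFamily (𝒜 : Set (Set ℕ)) : Set (Set ℕ) :=
  {M | M.Infinite ∧ {A | A ∈ 𝒜 ∧ (A ∩ M).Infinite}.Infinite}

/-- Complete separability: every `M ∈ 𝒜^*` contains a member of `𝒜`. -/
def IsCompletelySeparable (𝒜 : Set (Set ℕ)) : Prop :=
  ∀ M ∈ starFamily 𝒜, ∃ A ∈ 𝒜, A ⊆ M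

/-- The filter `ℱ_𝒟` of the sets that almost contain every member of `𝒟`. -/
def filterOf (𝒟 : Set (Set ℕ)) : Filter ℕ where
  sets := {F | ∀ D ∈ 𝒟, (D \ F).Finite}
  univ_sets := fun D _ => by simp
  sets_of_superset := fun h hFG D hD => (h D hD).subset (sdiff_subset_sdiff_right hFG)
  inter_sets := fun hF hG D hD => by
    rw [sdiff_inter]
    exact (hF D hD).union (hG D hD)

/-- The filter `S_𝒜`, dual to the ideal `ℐ(𝒜)`: its members are the complements of the members
of `ℐ(𝒜)`. -/
def dualFilter (𝒜 : Set (Set ℕ)) : Filter ℕ where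
  sets := {F | Fᶜ ∈ idealGen 𝒜}
  univ_sets := ⟨∅, empty_subset _, finite_empty, by simp⟩
  sets_of_superset := fun h hFG => by
    obtain ⟨ℬ, h1, h2, h3⟩ := h
    exact ⟨ℬ, h1, h2, h3.subset (sdiff_subset_sdiff_left (compl_subset_compl.2 hFG))⟩
  inter_sets := fun hF hG => by
    obtain ⟨ℬ, h1, h2, h3⟩ := hF
    obtain ⟨𝒞, k1, k2, k3⟩ := hG
    refine ⟨ℬ ∪ 𝒞, union_subset h1 k1, h2.union k2, (h3.union k3).subset ?_⟩
    rw [sUnion_union, compl_inter]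
    rintro n ⟨hn | hn, hn'⟩
    · exact Or.inl ⟨hn, fun h => hn' (Or.inl h)⟩
    · exact Or.inr ⟨hn, fun h => hn' (Or.inr h)⟩

/-- The Rudin-Keisler pre-order: `F ≤_RK G` iff `F = f[G]` for some `f : ω → ω`, where
`f[G] = {E | f⁻¹(E) ∈ G}` is `Filter.map f G`. -/
def RKLE (F G : Filter ℕ) : Prop := ∃ f : ℕ → ℕ, Filter.map f G = F

/-- Incomparability in the Rudin-Keisler pre-order. -/
def RKIncomparable (F G : Filter ℕ) : Prop := ¬ RKLE F G ∧ ¬ RKLE G F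

/-- An infinite partition of `ω` into infinite subsets. -/
structure IsInfinitePartition (𝒬 : Set (Set ℕ)) : Prop where
  isPartition : Setoid.IsPartition 𝒬
  infinite : 𝒬.Infinite
  infinite_of_mem : ∀ P ∈ 𝒬, P.Infinite

/-- The Cantor tree `2^{<ω}` of finite binary sequences. -/
abbrev CantorTree : Type := Σ n : ℕ, (Fin n → Bool)

/-- The branch `A_x = {x|n : n < ω}` of the Cantor tree determined by `x ∈ 2^ω`. -/
def branch (x : ℕ → Bool) : Set CantorTree :=
  range fun n : ℕ => (⟨n, fun i => x i⟩ : CantorTree)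

/-- The family `𝒜_X = {A_x : x ∈ X}`, viewed as a family of subsets of `ω` through the
identification `e` of the Cantor tree with `ω`. -/
def branchFamily (e : CantorTree ≃ ℕ) (X : Set (ℕ → Bool)) : Set (Set ℕ) :=
  (fun x => e '' branch x) '' X

end RKFilters

/-!
Write `ℐ(𝒜)` for the ideal generated by an almost disjoint family `𝒜`. Passing to complements,
`map f G = F` says that a set belongs to the dual ideal of `F` iff its preimage under `f` belongs
to the dual ideal of `G`. The dual ideal of `ℱ_𝒬`, for a partition `𝒬`, consists of the sets that
meet every piece in a finite set; it is a P-ideal, whereas `ℐ(𝒜)` is not, because a member of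
`ℐ(𝒜)` has infinite intersection with only finitely many members of `𝒜`
(`IsAD.finite_traces`). This makes `ℱ_𝒬` incomparable with the dual filter of any almost disjoint
family:

* if `S_𝒜 = f[ℱ_𝒬]`, a suitable diagonal union of a sequence in `𝒜` has a preimage that meets each
  piece in a finite set (`not_rkle_dualFilter_filterOf`);
* if `ℱ_𝒬 = f[S_𝒜]`, the preimages of the pieces are outside `ℐ(𝒜)`, so infinitely many members of
  `𝒜` meet a selector of these preimages in an infinite set; a diagonal union of countably many
  such selectors has an `f`-image meeting each piece in a finite set, although its preimage is not
  in `ℐ(𝒜)` (`not_rkle_filterOf_dualFilter`).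

The set `X` is found by diagonalizing against the continuum many pairs `(e, f)`. On one side,
`f[S_𝒜]` determines which branches lie in the dual ideal, hence determines `X`, so it suffices to
spoil one point of `2^ω` for every pair. On the other side, suppose `S_𝒜 = f[S_{𝒜_X}]`. Then `X`
contains every `x` whose branch meets some `f⁻¹(A)`, `A ∈ 𝒜`, in an infinite set. There are
continuum many such `x` (`mk_le_mk_traces`): otherwise infinitely many `f⁻¹(A)` would be almost
covered by the same finitely many branches, and trimming these `A` by finite sets would produce a
union that is outside `ℐ(𝒜)` but whose preimage is covered by these branches. So it suffices to
omit one of these `x` from `X`. Since each requirement offers continuum many points, distinct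
points can be used for all of them (`exists_injective_forall_mem`).
-/

namespace RKFilters

open Cardinal

/-! ### Ideals and the Rudin-Keisler order -/

theorem compl_mem_dualFilter {𝒜 : Set (Set ℕ)} {Y : Set ℕ} :
    Yᶜ ∈ dualFilter 𝒜 ↔ Y ∈ idealGen 𝒜 := by
  change Yᶜᶜ ∈ idealGen 𝒜 ↔ _
  rw [compl_compl]

theorem compl_mem_filterOf {𝒟 : Set (Set ℕ)} {Y : Set ℕ} :
    Yᶜ ∈ filterOf 𝒟 ↔ ∀ D ∈ 𝒟, (D ∩ Y).Finite := by
  change (∀ D ∈ 𝒟, (D \ Yᶜ).Finite) ↔ _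
  simp only [sdiff_compl]

theorem compl_mem_iff_of_map_eq {F G : Filter ℕ} {f : ℕ → ℕ} (h : Filter.map f G = F)
    (Y : Set ℕ) : Yᶜ ∈ F ↔ (f ⁻¹' Y)ᶜ ∈ G := by
  rw [← h, Filter.mem_map, preimage_compl]

theorem idealGen_of_subset {𝒜 : Set (Set ℕ)} {Y Z : Set ℕ} (hZ : Z ∈ idealGen 𝒜) (h : Y ⊆ Z) :
    Y ∈ idealGen 𝒜 := by
  obtain ⟨ℬ, h1, h2, h3⟩ := hZ
  exact ⟨ℬ, h1, h2, h3.subset (sdiff_subset_sdiff_left h)⟩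

theorem mem_idealGen_of_mem {𝒜 : Set (Set ℕ)} {A : Set ℕ} (h : A ∈ 𝒜) : A ∈ idealGen 𝒜 :=
  ⟨{A}, singleton_subset_iff.2 h, finite_singleton A, by simp⟩

/-- A member of `ℐ(𝒜)` is almost covered by finitely many members of `𝒜`, each of which meets it
in an infinite set. -/
theorem exists_finite_traces {𝒜 : Set (Set ℕ)} {Y : Set ℕ} (hY : Y ∈ idealGen 𝒜) :
    ∃ ℬ ⊆ {A | A ∈ 𝒜 ∧ (A ∩ Y).Infinite}, ℬ.Finite ∧ (Y \ ⋃₀ ℬ).Finite := by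
  obtain ⟨ℬ, h1, h2, h3⟩ := hY
  refine ⟨{A | A ∈ ℬ ∧ (A ∩ Y).Infinite}, fun A hA => ⟨h1 hA.1, hA.2⟩,
    h2.subset fun A hA => hA.1, ?_⟩
  have h4 : (⋃ A ∈ {A | A ∈ ℬ ∧ (A ∩ Y).Finite}, A ∩ Y).Finite :=
    (h2.subset fun A hA => hA.1).biUnion fun A hA => hA.2
  refine (h3.union h4).subset ?_
  rintro y ⟨hy, hn⟩
  by_cases hc : y ∈ ⋃₀ ℬ
  · obtain ⟨A, hA, hyA⟩ := hc
    refine Or.inr (mem_biUnion (x := A) ⟨hA, ?_⟩ ⟨hyA, hy⟩)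
    by_contra hinf
    exact hn ⟨A, ⟨hA, hinf⟩, hyA⟩
  · exact Or.inl ⟨hy, hc⟩

theorem exists_infinite_inter {𝒜 : Set (Set ℕ)} {Y : Set ℕ} (hY : Y ∈ idealGen 𝒜)
    (hinf : Y.Infinite) : ∃ A ∈ 𝒜, (A ∩ Y).Infinite := by
  obtain ⟨ℬ, h1, h2, h3⟩ := exists_finite_traces hY
  rcases ℬ.eq_empty_or_nonempty with rfl | ⟨A, hA⟩
  · simp only [sUnion_empty, sdiff_empty] at h3
    exact absurd h3 hinf
  · exact ⟨A, h1 hA⟩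

/-- In an almost disjoint family, a member of `ℐ(𝒜)` has infinite intersection with only finitely
many members of `𝒜`. -/
theorem IsAD.finite_traces {𝒜 : Set (Set ℕ)} (h𝒜 : IsAD 𝒜) {Y : Set ℕ} (hY : Y ∈ idealGen 𝒜) :
    {A | A ∈ 𝒜 ∧ (A ∩ Y).Infinite}.Finite := by
  obtain ⟨ℬ, h1, h2, h3⟩ := hY
  refine h2.subset ?_
  rintro A ⟨hA, hinf⟩
  by_contra hAB
  refine hinf ((h3.union (h2.biUnion fun B hB =>
    h𝒜.finite_inter A hA B (h1 hB) fun h => hAB (h ▸ hB))).subset ?_)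
  rintro y ⟨hyA, hyY⟩
  by_cases hc : y ∈ ⋃₀ ℬ
  · obtain ⟨B, hB, hyB⟩ := hc
    exact Or.inr (mem_biUnion hB ⟨hyA, hyB⟩)
  · exact Or.inl ⟨hyY, hc⟩

theorem IsAD.notMem_idealGen {𝒜 : Set (Set ℕ)} (h𝒜 : IsAD 𝒜) {Y : Set ℕ} {A : ℕ → Set ℕ}
    (hA : ∀ i, A i ∈ 𝒜) (hinj : Function.Injective A) (hY : ∀ i, (A i ∩ Y).Infinite) :
    Y ∉ idealGen 𝒜 := fun h =>
  (infinite_range_of_injective hinj).mono (by rintro _ ⟨i, rfl⟩; exact ⟨hA i, hY i⟩)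
    (h𝒜.finite_traces h)

/-! ### Partitions versus almost disjoint families -/

theorem not_rkle_dualFilter_filterOf {𝒜 𝒬 : Set (Set ℕ)} (h𝒜 : IsAD 𝒜)
    (h𝒬 : Setoid.IsPartition 𝒬) : ¬ RKLE (dualFilter 𝒜) (filterOf 𝒬) := by
  rintro ⟨f, hf⟩
  have key : ∀ Y, Y ∈ idealGen 𝒜 ↔ ∀ D ∈ 𝒬, (D ∩ f ⁻¹' Y).Finite := fun Y => by
    rw [← compl_mem_dualFilter, compl_mem_iff_of_map_eq hf, compl_mem_filterOf]
  -- Enumerating the pieces with repetitions, as the pieces containing `0, 1, 2, …`, is enough.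
  choose P hP _ using h𝒬.2
  simp only at hP
  have hsurj : ∀ D ∈ 𝒬, ∃ j, P j = D := fun D hD => by
    obtain ⟨j, hj⟩ := Setoid.nonempty_of_mem_partition h𝒬 hD
    exact ⟨j, (h𝒬.2 j).unique (hP j) ⟨hD, hj⟩⟩
  let A : ℕ → Set ℕ := fun i => h𝒜.infinite.natEmbedding _ i
  have hA : ∀ i, A i ∈ 𝒜 := fun i => (h𝒜.infinite.natEmbedding _ i).2
  have hAinj : Function.Injective A :=
    Subtype.val_injective.comp (h𝒜.infinite.natEmbedding _).injective
  have hfin : ∀ i j, (P j ∩ f ⁻¹' A i).Finite := fun i j =>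
    (key _).1 (mem_idealGen_of_mem (hA i)) _ (hP j).1
  let E : Set ℕ := ⋃ i, A i \ ⋃ j ∈ Iic i, f '' P j
  have hE : E ∈ idealGen 𝒜 := by
    rw [key]
    intro D hD
    obtain ⟨j, rfl⟩ := hsurj D hD
    refine ((finite_Iio j).biUnion fun i _ => hfin i j).subset ?_
    rintro x ⟨hx, hxE⟩
    obtain ⟨i, hi, hn⟩ := mem_iUnion.1 hxE
    refine mem_biUnion (x := i) ?_ ⟨hx, hi⟩
    by_contra hij
    exact hn (mem_biUnion (x := j) (mem_Iic.2 (not_lt.1 hij)) ⟨x, hx, rfl⟩)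
  refine h𝒜.notMem_idealGen hA hAinj (fun i => ?_) hE
  have h1 : (A i ∩ ⋃ j ∈ Iic i, f '' P j).Finite := by
    refine ((finite_Iic i).biUnion fun j _ => (hfin i j).image f).subset ?_
    rintro y ⟨hy, hy'⟩
    obtain ⟨j, hj, x, hx, rfl⟩ := mem_iUnion₂.1 hy'
    exact mem_biUnion hj ⟨x, ⟨hx, hy⟩, rfl⟩
  refine ((h𝒜.infinite_of_mem _ (hA i)).sdiff h1).mono ?_
  rintro y ⟨hy, hn⟩
  exact ⟨hy, mem_iUnion.2 ⟨i, hy, fun h => hn ⟨hy, h⟩⟩⟩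

theorem not_rkle_filterOf_dualFilter {𝒜 𝒬 : Set (Set ℕ)} (h𝒜 : IsAD 𝒜)
    (h𝒬 : IsInfinitePartition 𝒬) : ¬ RKLE (filterOf 𝒬) (dualFilter 𝒜) := by
  rintro ⟨f, hf⟩
  have key : ∀ Y, (∀ D ∈ 𝒬, (D ∩ Y).Finite) ↔ f ⁻¹' Y ∈ idealGen 𝒜 := fun Y => by
    rw [← compl_mem_filterOf, compl_mem_iff_of_map_eq hf, compl_mem_dualFilter]
  let P : ℕ → Set ℕ := fun i => h𝒬.infinite.natEmbedding _ i
  have hP : ∀ i, P i ∈ 𝒬 := fun i => (h𝒬.infinite.natEmbedding _ i).2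
  have hPinj : Function.Injective P :=
    Subtype.val_injective.comp (h𝒬.infinite.natEmbedding _).injective
  have huniq : ∀ {D D' : Set ℕ} {y : ℕ}, D ∈ 𝒬 → D' ∈ 𝒬 → y ∈ D → y ∈ D' → D = D' :=
    fun hD hD' h h' => (h𝒬.isPartition.2 _).unique ⟨hD, h⟩ ⟨hD', h'⟩
  have hpre : ∀ n, f ⁻¹' P n ∉ idealGen 𝒜 := fun n h => by
    have := (key _).2 h _ (hP n)
    rw [inter_self] at this
    exact h𝒬.infinite_of_mem _ (hP n) this
  -- Picking finitely many points from each `P n` yields a set in the dual ideal of `ℱ_𝒬`.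
  have hsel : ∀ F : ℕ → Set ℕ, (∀ n, (F n).Finite) → (∀ n, F n ⊆ P n) →
      f ⁻¹' (⋃ n, F n) ∈ idealGen 𝒜 := by
    intro F hF hFP
    rw [← key]
    intro D hD
    by_cases hDP : ∃ n, P n = D
    · obtain ⟨n, rfl⟩ := hDP
      refine (hF n).subset ?_
      rintro y ⟨hy, hy'⟩
      obtain ⟨m, hm⟩ := mem_iUnion.1 hy'
      have : m = n := hPinj (huniq (hP m) (hP n) (hFP m hm) hy)
      exact this ▸ hm
    · refine finite_empty.subset ?_
      rintro y ⟨hy, hy'⟩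
      obtain ⟨m, hm⟩ := mem_iUnion.1 hy'
      exact hDP ⟨m, huniq (hP m) hD (hFP m hm) hy⟩
  let K : Set (Set ℕ) :=
    {A | A ∈ 𝒜 ∧ ∃ x : ℕ → ℕ, (∀ n, f (x n) ∈ P n) ∧ (A ∩ range x).Infinite}
  have hxinj : ∀ x : ℕ → ℕ, (∀ n, f (x n) ∈ P n) → Function.Injective x :=
    fun x hx m n hmn => hPinj (huniq (hP m) (hP n) (hx m) (hmn ▸ hx n))
  have hK : K.Infinite := by
    intro hfin
    have hUK : ⋃₀ K ∈ idealGen 𝒜 := ⟨K, fun A hA => hA.1, hfin, by simp⟩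
    -- If `K` were finite, a selector avoiding `⋃₀ K` would be almost disjoint from all of `𝒜`.
    have hex : ∀ n, ∃ x, f x ∈ P n ∧ x ∉ ⋃₀ K := fun n => by
      by_contra! hcon
      exact hpre n (idealGen_of_subset hUK hcon)
    choose x hx hxK using hex
    have hr : range x ∈ idealGen 𝒜 := by
      refine idealGen_of_subset (hsel (fun n => {f (x n)}) (fun n => finite_singleton _)
        fun n => singleton_subset_iff.2 (hx n)) ?_
      rintro _ ⟨n, rfl⟩
      exact mem_iUnion.2 ⟨n, rfl⟩
    obtain ⟨A, hA, hinf⟩ :=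
      exists_infinite_inter hr (infinite_range_of_injective (hxinj x hx))
    obtain ⟨_, hyA, n, rfl⟩ := hinf.nonempty
    exact hxK n ⟨A, ⟨hA, x, hx, hinf⟩, hyA⟩
  let A : ℕ → Set ℕ := fun i => hK.natEmbedding _ i
  have hA : ∀ i, A i ∈ K := fun i => (hK.natEmbedding _ i).2
  have hAinj : Function.Injective A := Subtype.val_injective.comp (hK.natEmbedding _).injective
  choose x hx hinf using fun i => (hA i).2
  refine h𝒜.notMem_idealGen (fun i => (hA i).1) hAinj (fun i => ?_)
    (hsel (fun n => (fun i => f (x i n)) '' Iic n) (fun n => (finite_Iic n).image _) ?_)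
  · refine ((hinf i).sdiff ((finite_Iio i).image (x i))).mono ?_
    rintro _ ⟨⟨hy, n, rfl⟩, hn⟩
    refine ⟨hy, mem_iUnion.2 ⟨n, i, ?_, rfl⟩⟩
    by_contra hlt
    exact hn ⟨n, mem_Iio.2 (not_le.1 hlt), rfl⟩
  · rintro n _ ⟨i, _, rfl⟩
    exact hx i n

theorem rkIncomparable_filterOf_dualFilter {𝒜 𝒬 : Set (Set ℕ)} (h𝒜 : IsAD 𝒜)
    (h𝒬 : IsInfinitePartition 𝒬) : RKIncomparable (filterOf 𝒬) (dualFilter 𝒜) :=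
  ⟨not_rkle_filterOf_dualFilter h𝒜 h𝒬, not_rkle_dualFilter_filterOf h𝒜 h𝒬.isPartition⟩

/-! ### Families of branches -/

theorem infinite_branch (x : ℕ → Bool) : (branch x).Infinite :=
  infinite_range_of_injective fun _ _ h => congrArg Sigma.fst h

theorem eq_of_infinite_branch_inter {x y : ℕ → Bool} (h : (branch x ∩ branch y).Infinite) :
    x = y := by
  funext i
  have hfin : ((fun n : ℕ => (⟨n, fun i => x i⟩ : CantorTree)) '' Iic i).Finite :=
    (finite_Iic i).image _
  obtain ⟨t, ⟨⟨n, rfl⟩, ⟨m, hm⟩⟩, hn⟩ := (h.sdiff hfin).nonempty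
  have hlt : i < n := by
    by_contra hle
    exact hn ⟨n, mem_Iic.2 (not_lt.1 hle), rfl⟩
  obtain rfl : m = n := congrArg Sigma.fst hm
  simp only [Sigma.mk.injEq, heq_eq_eq, true_and] at hm
  exact (congrFun hm ⟨i, hlt⟩).symm

theorem eq_of_infinite_image_branch_inter {e : CantorTree ≃ ℕ} {x y : ℕ → Bool}
    (h : (e '' branch x ∩ e '' branch y).Infinite) : x = y := by
  rw [← image_inter e.injective] at h
  exact eq_of_infinite_branch_inter h.of_image

theorem infinite_image_branch (e : CantorTree ≃ ℕ) (x : ℕ → Bool) :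
    (e '' branch x).Infinite :=
  (infinite_branch x).image e.injective.injOn

theorem image_branch_injective (e : CantorTree ≃ ℕ) :
    Function.Injective fun x : ℕ → Bool => e '' branch x := fun x y h => by
  refine eq_of_infinite_image_branch_inter (e := e) ?_
  rw [show e '' branch x = e '' branch y from h, inter_self]
  exact infinite_image_branch e y

theorem isAD_branchFamily (e : CantorTree ≃ ℕ) {X : Set (ℕ → Bool)} (hX : X.Infinite) :
    IsAD (branchFamily e X) where
  infinite := hX.image (image_branch_injective e).injOn
  infinite_of_mem := by
    rintro _ ⟨x, _, rfl⟩
    exact infinite_image_branch e x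
  finite_inter := by
    rintro _ ⟨x, _, rfl⟩ _ ⟨y, _, rfl⟩ hne
    by_contra h
    exact hne (by rw [eq_of_infinite_image_branch_inter h])

theorem mem_of_infinite_image_branch_inter {e : CantorTree ≃ ℕ} {X : Set (ℕ → Bool)}
    {x : ℕ → Bool} {Y : Set ℕ} (hY : Y ∈ idealGen (branchFamily e X))
    (h : (e '' branch x ∩ Y).Infinite) : x ∈ X := by
  obtain ⟨_, ⟨y, hy, rfl⟩, hinf⟩ :=
    exists_infinite_inter (idealGen_of_subset hY inter_subset_right) h
  rwa [eq_of_infinite_image_branch_inter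
    (hinf.mono fun n hn => ⟨hn.2.1, hn.1⟩ : (e '' branch x ∩ e '' branch y).Infinite)]

theorem image_branch_mem_idealGen_iff {e : CantorTree ≃ ℕ} {X : Set (ℕ → Bool)} {x : ℕ → Bool} :
    e '' branch x ∈ idealGen (branchFamily e X) ↔ x ∈ X := by
  refine ⟨fun h => mem_of_infinite_image_branch_inter h ?_,
    fun h => mem_idealGen_of_mem ⟨x, h, rfl⟩⟩
  rw [inter_self]
  exact infinite_image_branch e x

/-! ### Diagonalization -/

/-- If `f` maps the dual filter of `ℬ` to that of an uncountable almost disjoint family `𝒜`, then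
the members of `ℬ` that meet the preimage of some member of `𝒜` in an infinite set are at least as
many as the members of `𝒜`. -/
theorem mk_le_mk_traces {𝒜 ℬ : Set (Set ℕ)} (h𝒜 : IsAD 𝒜) (hunc : ℵ₀ < #𝒜) {f : ℕ → ℕ}
    (hf : Filter.map f (dualFilter ℬ) = dualFilter 𝒜) :
    #𝒜 ≤ #{B | B ∈ ℬ ∧ ∃ A ∈ 𝒜, (B ∩ f ⁻¹' A).Infinite} := by
  have key : ∀ Y, Y ∈ idealGen 𝒜 ↔ f ⁻¹' Y ∈ idealGen ℬ := fun Y => by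
    rw [← compl_mem_dualFilter, compl_mem_iff_of_map_eq hf, compl_mem_dualFilter]
  set T : Set (Set ℕ) := {B | B ∈ ℬ ∧ ∃ A ∈ 𝒜, (B ∩ f ⁻¹' A).Infinite} with hT
  by_contra! hlt
  have hcov : ∀ A : 𝒜, ∃ G : Finset T, (f ⁻¹' A \ ⋃ B ∈ G, (B : Set ℕ)).Finite := fun A => by
    obtain ⟨𝒞, h1, h2, h3⟩ := exists_finite_traces ((key A).1 (mem_idealGen_of_mem A.2))
    have hsub : 𝒞 ⊆ T := fun B hB => ⟨(h1 hB).1, A, A.2, (h1 hB).2⟩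
    refine ⟨(h2.preimage Subtype.val_injective.injOn : (Subtype.val ⁻¹' 𝒞 : Set T).Finite).toFinset,
      h3.subset ?_⟩
    rintro y ⟨hy, hn⟩
    refine ⟨hy, ?_⟩
    rintro ⟨B, hB, hyB⟩
    exact hn (mem_biUnion (x := (⟨B, hsub hB⟩ : T)) (by simpa using hB) hyB)
  choose G hG using hcov
  have hfins : #(Finset T) < #𝒜 := by
    rcases finite_or_infinite T with hT' | hT'
    · exact (mk_le_aleph0 (α := Finset T)).trans_lt hunc
    · rwa [mk_finset_of_infinite]
  have : Infinite 𝒜 := h𝒜.infinite.to_subtype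
  obtain ⟨G₀, hG₀⟩ := exists_infinite_fiber G hfins
  let A : ℕ → Set ℕ := fun i => (Infinite.natEmbedding (G ⁻¹' {G₀}) i : 𝒜)
  have hA : ∀ i, A i ∈ 𝒜 := fun i => (Infinite.natEmbedding (G ⁻¹' {G₀}) i : 𝒜).2
  have hAinj : Function.Injective A := Subtype.val_injective.comp
    (Subtype.val_injective.comp (Infinite.natEmbedding (G ⁻¹' {G₀})).injective)
  let U : Set ℕ := ⋃ B ∈ G₀, (B : Set ℕ)
  have hU : U ∈ idealGen ℬ := by
    refine ⟨Subtype.val '' (G₀ : Set T), ?_, G₀.finite_toSet.image _, ?_⟩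
    · rintro _ ⟨B, _, rfl⟩
      exact B.2.1
    · refine finite_empty.subset ?_
      rintro y ⟨hy, hn⟩
      obtain ⟨B, hB, hyB⟩ := mem_iUnion₂.1 hy
      exact hn ⟨B, ⟨B, hB, rfl⟩, hyB⟩
  have hAU : ∀ i, (f ⁻¹' A i \ U).Finite := fun i => by
    have h := hG (Infinite.natEmbedding (G ⁻¹' {G₀}) i : 𝒜)
    rwa [show G (Infinite.natEmbedding (G ⁻¹' {G₀}) i : 𝒜) = G₀ from
      (Infinite.natEmbedding (G ⁻¹' {G₀}) i).2] at h
  -- Removing the finite sets `f '' (f ⁻¹' A i \ U)` moves the whole preimage of the union into `U`.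
  let M : Set ℕ := ⋃ i, A i \ f '' (f ⁻¹' A i \ U)
  refine h𝒜.notMem_idealGen (Y := M) hA hAinj (fun i => ?_) ((key M).2 (idealGen_of_subset hU ?_))
  · refine ((h𝒜.infinite_of_mem _ (hA i)).sdiff ((hAU i).image f)).mono fun y hy => ?_
    exact ⟨hy.1, mem_iUnion.2 ⟨i, hy⟩⟩
  · intro y hy
    obtain ⟨i, hi, hn⟩ := mem_iUnion.1 hy
    by_contra hyU
    exact hn ⟨y, ⟨hi, hyU⟩, rfl⟩

/-- A family of sets whose members are at least as large as its index set has an injective choice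
function. -/
theorem exists_injective_forall_mem {ι α : Type} (S : ι → Set α) (hS : ∀ i, #ι ≤ #(S i)) :
    ∃ s : ι → α, Function.Injective s ∧ ∀ i, s i ∈ S i := by
  -- For a well-order of minimal type, fewer than `#ι` points are in use at every stage.
  obtain ⟨r, hr, hord⟩ := exists_ord_eq ι
  have hex : ∀ (i : ι) (g : ∀ j, r j i → α), ∃ a ∈ S i, ∀ j (hj : r j i), g j hj ≠ a := by
    intro i g
    by_contra! hcon
    have h1 : S i ⊆ range fun j : {j // r j i} => g j.1 j.2 := fun a ha => by
      obtain ⟨j, hj, h⟩ := hcon a ha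
      exact ⟨⟨j, hj⟩, h⟩
    have h2 : #{j // r j i} < #ι := by
      have := card_typein_lt i hord
      rwa [Ordinal.card_typein] at this
    exact (((hS i).trans (mk_le_mk_of_subset h1)).trans mk_range_le).not_gt h2
  choose c hc hne using hex
  have hwf : WellFounded r := hr.wf
  have hfix : ∀ i, hwf.fix c i = c i fun j _ => hwf.fix c j := fun i => hwf.fix_eq c i
  have hlt : ∀ i j, r j i → hwf.fix c j ≠ hwf.fix c i := fun i j hj => by
    rw [hfix i]
    exact hne i (fun j _ => hwf.fix c j) j hj
  refine ⟨hwf.fix c, fun i j hij => ?_, fun i => ?_⟩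
  · by_contra hij'
    rcases trichotomous_of r i j with h | h | h
    · exact hlt j i h hij
    · exact hij' h
    · exact hlt i j h hij.symm
  · rw [hfix i]
    exact hc i _

theorem mk_equiv_prod_le : #((CantorTree ≃ ℕ) × (ℕ → ℕ)) ≤ 𝔠 := by
  have h1 : #(CantorTree ≃ ℕ) ≤ 𝔠 := by
    refine (mk_le_of_injective (f := fun e : CantorTree ≃ ℕ => (e : CantorTree → ℕ))
      DFunLike.coe_injective).trans ?_
    simp
  have h2 : #(ℕ → ℕ) ≤ 𝔠 := by simp
  rw [mk_prod, lift_id, lift_id]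
  exact (mul_le_mul' h1 h2).trans_eq continuum_mul_self

/-- The points whose branch meets the `f`-preimage of some member of `𝒜` in an infinite set. If
`S_𝒜` is the image of `S_{𝒜_X}` under `f`, these points belong to `X`. -/
def branchTraces (𝒜 : Set (Set ℕ)) (p : (CantorTree ≃ ℕ) × (ℕ → ℕ)) : Set (ℕ → Bool) :=
  {x | ∃ A ∈ 𝒜, (p.1 '' branch x ∩ p.2 ⁻¹' A).Infinite}

theorem branchTraces_subset {𝒜 : Set (Set ℕ)} {X : Set (ℕ → Bool)} {e : CantorTree ≃ ℕ} {f : ℕ → ℕ}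
    (hf : Filter.map f (dualFilter (branchFamily e X)) = dualFilter 𝒜) :
    branchTraces 𝒜 (e, f) ⊆ X := by
  rintro x ⟨A, hA, hinf⟩
  refine mem_of_infinite_image_branch_inter (Y := f ⁻¹' A) ?_ hinf
  rw [← compl_mem_dualFilter, ← compl_mem_iff_of_map_eq hf, compl_mem_dualFilter]
  exact mem_idealGen_of_mem hA

theorem continuum_le_mk_branchTraces {𝒜 : Set (Set ℕ)} (h𝒜 : IsAD 𝒜) (hcard : #𝒜 = 𝔠)
    {X : Set (ℕ → Bool)} {e : CantorTree ≃ ℕ} {f : ℕ → ℕ}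
    (hf : Filter.map f (dualFilter (branchFamily e X)) = dualFilter 𝒜) :
    𝔠 ≤ #(branchTraces 𝒜 (e, f)) := by
  have h1 := mk_le_mk_traces h𝒜 (hcard ▸ aleph0_lt_continuum) hf
  rw [hcard] at h1
  refine h1.trans ((mk_le_mk_of_subset ?_).trans
    (mk_image_le (f := fun x => e '' branch x) (s := branchTraces 𝒜 (e, f))))
  rintro _ ⟨⟨x, _, rfl⟩, A, hA, hinf⟩
  exact ⟨x, ⟨A, hA, hinf⟩, rfl⟩

/-- Every almost disjoint family of size continuum has an infinite `X ⊆ 2^ω` such that, for each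
identification of the Cantor tree with `ω`, its dual filter is incomparable with that of `𝒜_X`. -/
theorem exists_rkIncomparable_branchFamily {𝒜 : Set (Set ℕ)} (h𝒜 : IsAD 𝒜) (hcard : #𝒜 = 𝔠) :
    ∃ X : Set (ℕ → Bool), X.Infinite ∧
      ∀ e : CantorTree ≃ ℕ, RKIncomparable (dualFilter 𝒜) (dualFilter (branchFamily e X)) := by
  classical
  let Γ := (CantorTree ≃ ℕ) × (ℕ → ℕ)
  -- `inl p` yields a point to be omitted from `X`, `inr (inl p)` a point that decides against
  -- `S_{𝒜_X} = p.2[S_𝒜]`, and the points of `inr (inr n)` make `X` infinite.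
  let S : Γ ⊕ (Γ ⊕ ℕ) → Set (ℕ → Bool) :=
    Sum.elim (fun p => if 𝔠 ≤ #(branchTraces 𝒜 p) then branchTraces 𝒜 p else univ) fun _ => univ
  have huniv : 𝔠 ≤ #(univ : Set (ℕ → Bool)) := by simp
  have hι : #(Γ ⊕ (Γ ⊕ ℕ)) ≤ 𝔠 := by
    simp only [mk_sum, lift_id]
    refine (add_le_add mk_equiv_prod_le (add_le_add mk_equiv_prod_le
      (mk_nat.le.trans aleph0_le_continuum))).trans ?_
    simp
  obtain ⟨s, hs, hsS⟩ := exists_injective_forall_mem S fun i => by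
    refine hι.trans ?_
    rcases i with p | i
    · by_cases h : 𝔠 ≤ #(branchTraces 𝒜 p)
      · simpa only [S, Sum.elim_inl, if_pos h] using h
      · simpa only [S, Sum.elim_inl, if_neg h] using huniv
    · exact huniv
  let X : Set (ℕ → Bool) := s '' (Sum.inr '' (Sum.inl ''
    {p : Γ | p.2 ⁻¹' (p.1 '' branch (s (Sum.inr (Sum.inl p)))) ∉ idealGen 𝒜} ∪ range Sum.inr))
  refine ⟨X, ?_, fun e => ⟨?_, ?_⟩⟩
  · exact (((infinite_range_of_injective Sum.inr_injective).mono subset_union_right).image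
      Sum.inr_injective.injOn).image hs.injOn
  · rintro ⟨f, hf⟩
    have hmem := hsS (Sum.inl (e, f))
    simp only [S, Sum.elim_inl, if_pos (continuum_le_mk_branchTraces h𝒜 hcard hf)] at hmem
    have hX := branchTraces_subset hf hmem
    rw [hs.mem_set_image] at hX
    simp at hX
  · rintro ⟨f, hf⟩
    have h1 : s (Sum.inr (Sum.inl (e, f))) ∈ X ↔
        f ⁻¹' (e '' branch (s (Sum.inr (Sum.inl (e, f))))) ∈ idealGen 𝒜 := by
      rw [← image_branch_mem_idealGen_iff (e := e), ← compl_mem_dualFilter,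
        compl_mem_iff_of_map_eq hf, compl_mem_dualFilter]
    rw [hs.mem_set_image, Sum.inr_injective.mem_set_image] at h1
    simp at h1

end RKFilters

theorem mainTheorem6 (𝒜 : Set (Set ℕ)) (hNMAD : RKFilters.IsNMAD 𝒜)
    (hsep : RKFilters.IsCompletelySeparable 𝒜) (hcard : Cardinal.mk 𝒜 = Cardinal.continuum) :
    ∃ X : Set (ℕ → Bool), X.Infinite ∧
      ∀ (e : RKFilters.CantorTree ≃ ℕ) (𝒬 : Set (Set ℕ)), RKFilters.IsInfinitePartition 𝒬 →
        RKFilters.RKIncomparable (RKFilters.filterOf 𝒬) (RKFilters.dualFilter 𝒜) ∧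
        RKFilters.RKIncomparable (RKFilters.filterOf 𝒬)
          (RKFilters.dualFilter (RKFilters.branchFamily e X)) ∧
        RKFilters.RKIncomparable (RKFilters.dualFilter 𝒜)
          (RKFilters.dualFilter (RKFilters.branchFamily e X)) := by
  obtain ⟨X, hX, hinc⟩ := RKFilters.exists_rkIncomparable_branchFamily hNMAD.1 hcard
  exact ⟨X, hX, fun e 𝒬 h𝒬 => ⟨RKFilters.rkIncomparable_filterOf_dualFilter hNMAD.1 h𝒬,
    RKFilters.rkIncomparable_filterOf_dualFilter (RKFilters.isAD_branchFamily e hX) h𝒬, hinc e⟩⟩
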